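/- Let $n\ge 2$, let $a=\exp(2\pi i/n)$, and let $$D=\mathrm{diag}(1,a,a^2,\ldots,a^{n-1}),\qquad S=\sum_{j=1}^{n-1}E_{j,j+1}+E_{n,1}$$ be Sylvester's generators (the clock and shift matrices) in $\mathrm{Mat}_n(\mathbb C)$, where $E_{i,j}$ are the matrix units. Let $\mathfrak F$ be the free complex Lie algebra on two letters $x_D,x_S$ and let $\pi_n:\mathfrak F\to\mathrm{Mat}_n(\mathbb C)$ be the homomorphism of Lie algebras (with the commutator bracket on matrices) such that $\pi_n(x_D)=D$ and $\pi_n(x_S)=S$. A set $\mathcal R\subset\mathfrak F$ is called a set of defining relations of $\mathfrak{sl}(n)=\mathfrak{sl}(n,\mathbb C)$ for the generators $D,S$ if $\pi_n(\mathfrak F)=\mathfrak{sl}(n)$ and the ideal of $\mathfrak F$ generated by $\mathcal R$ is $\ker\pi_n$; it is called independent if no $r\in\mathcal R$ lies in the ideal generated by $\mathcal R\setminus\{r\}$. Let $R(n)$ be the least number of elements of an independent set of defining relations of $\mathfrak{sl}(n)$ for the generators $D,S$ ($R(n)=\infty$ if there is no finite such set). **Theorem.** $$R(n)\le\begin{cases}2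 & \text{for } n=2,\\ n^2-3 & \text{for } n\ge 3.\end{cases}$$ -/

import Mathlib

noncomputable section

namespace Sylvester

attribute [local instance 100] LieRing.ofAssociativeRing

/-- The primitive `n`-th root of unity `a = exp (2πi/n)`. -/
def rootA (n : ℕ) : ℂ := Complex.exp (2 * Real.pi * Complex.I / n)

/-- The clock matrix `D = diag (1, a, a², …, aⁿ⁻¹)`. -/
def clock (n : ℕ) : Matrix (Fin n) (Fin n) ℂ :=
  Matrix.diagonal fun i => rootA n ^ (i : ℕ)

/-- The shift matrix `S`: ones just above the diagonal and in the lower left corner. -/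
def shift (n : ℕ) : Matrix (Fin n) (Fin n) ℂ :=
  Matrix.of fun i j => if (j : ℕ) = ((i : ℕ) + 1) % n then 1 else 0

/-- Names of the two abstract generators. -/
inductive Gen : Type
  | D
  | S

/-- The value of an abstract generator in the `n × n` matrices. -/
def genMatrix (n : ℕ) : Gen → Matrix (Fin n) (Fin n) ℂ
  | Gen.D => clock n
  | Gen.S => shift n

/-- The free complex Lie algebra on the two letters `D` and `S`. -/
abbrev FreeLie : Type := FreeLieAlgebra ℂ Gen

/-- The evaluation of Lie polynomials in the letters `D`, `S` at Sylvester's matrices.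
A relation between Sylvester's generators is an element of its kernel
(an equation `u = v` is the element `u - v`). -/
def evalHom (n : ℕ) : FreeLie →ₗ⁅ℂ⁆ Matrix (Fin n) (Fin n) ℂ :=
  FreeLieAlgebra.lift ℂ (genMatrix n)

/-- `R` is a set of defining relations of `sl(n)` for Sylvester's generators: the matrices `D`, `S`
generate exactly `sl(n)`, and the ideal of all relations between them is the Lie ideal
generated by `R`. In other words, evaluation induces an isomorphism from the free Lie algebra
modulo the ideal generated by `R` onto `sl(n)`. -/
def IsDefining (n : ℕ) (R : Set FreeLie) : Prop :=
  (evalHom n).range = LieAlgebra.SpecialLinear.sl (Fin n) ℂ ∧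
    LieSubmodule.lieSpan ℂ FreeLie R = (evalHom n).ker

/-- No relation in `R` is a consequence of the remaining ones. -/
def IsIndependent (R : Set FreeLie) : Prop :=
  ∀ r ∈ R, r ∉ LieSubmodule.lieSpan ℂ FreeLie (R \ {r})

/-- The number `R(n)` of independent defining relations between Sylvester's generators of `sl(n)`:
the least cardinality of an independent set of defining relations (`⊤` if there is no finite
one). -/
def relationNumber (n : ℕ) : ℕ∞ :=
  sInf {c : ℕ∞ | ∃ R : Set FreeLie, IsDefining n R ∧ IsIndependent R ∧ R.encard = c}

end Sylvester

end

/-! The matrices `D` and `S` commute up to the factor `a`, so conjugation by them is diagonal on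
the monomials `Dⁱ Sʲ`, and comparing eigenvalues shows that these are linearly independent and that
those different from `1` have trace zero: they form a basis of `sl(n)`. By `q`-commutation, a
bracket of `D` or `S` with a monomial is a multiple of a monomial, so every monomial other than `1`
is, up to a nonzero factor, the value of an iterated bracket of the letters. The chosen iterated
brackets span a complement of the kernel of evaluation. Hence the kernel is generated by the
relations which rewrite `⁅X, w⁆`, for a letter `X` and a chosen bracket `w`, in terms of the chosen
brackets. Of the `2 (n² - 1)` pairs `(X, w)`, all but `n² - 2` give nothing new, since `⁅X, w⁆` is
`0` or, up to sign, again a chosen bracket; for `n ≥ 3` the Jacobi identity `⁅D, ⁅S, ⁅D, S⁆⁆⁆ = ⁅S,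
⁅D, ⁅D, S⁆⁆⁆` saves one more relation. -/

namespace Sylvester

attribute [local instance 100] LieRing.ofAssociativeRing

section Presentation

variable {R L L' : Type*} [CommRing R] [LieRing L] [LieAlgebra R L] [LieRing L'] [LieAlgebra R L']

theorem eq_top_of_forall_lie_mem {G : Set L} (hG : LieSubalgebra.lieSpan R L G = ⊤)
    {U : Submodule R L} (hGU : G ⊆ U) (hU : ∀ g ∈ G, ∀ u ∈ U, ⁅g, u⁆ ∈ U) : U = ⊤ := by
  have mem_lieSpan (z : L) : z ∈ LieSubalgebra.lieSpan R L G := hG ▸ LieSubalgebra.mem_top z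
  have lie_mem (z : L) : ∀ u ∈ U, ⁅z, u⁆ ∈ U := by
    induction mem_lieSpan z using LieSubalgebra.lieSpan_induction with
    | mem g hg => exact hU g hg
    | zero => simp
    | add a b _ _ ha hb => exact fun u hu ↦ add_lie a b u ▸ U.add_mem (ha u hu) (hb u hu)
    | smul c a _ ha => exact fun u hu ↦ smul_lie c a u ▸ U.smul_mem c (ha u hu)
    | lie a b _ _ ha hb =>
      exact fun u hu ↦ lie_lie a b u ▸ U.sub_mem (ha _ (hb u hu)) (hb _ (ha u hu))
  refine eq_top_iff.2 fun z _ ↦ ?_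
  induction mem_lieSpan z using LieSubalgebra.lieSpan_induction with
  | mem g hg => exact hGU hg
  | zero => exact U.zero_mem
  | add a b _ _ ha hb => exact U.add_mem (ha trivial) (hb trivial)
  | smul c a _ ha => exact U.smul_mem c (ha trivial)
  | lie a b _ _ _ hb => exact lie_mem a b (hb trivial)

theorem lieSpan_eq_ker {G S : Set L} (hG : LieSubalgebra.lieSpan R L G = ⊤) {φ : L →ₗ⁅R⁆ L'}
    {V : Submodule R L} (hV : Disjoint V φ.ker.toSubmodule) (hGV : G ⊆ V) (hS : S ⊆ φ.ker)
    (hlie : ∀ g ∈ G, ∀ v ∈ V, ⁅g, v⁆ ∈ V ⊔ (LieSubmodule.lieSpan R L S).toSubmodule) :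
    LieSubmodule.lieSpan R L S = φ.ker := by
  have lieSpan_le : LieSubmodule.lieSpan R L S ≤ φ.ker := LieSubmodule.lieSpan_le.2 hS
  have sup_eq_top : V ⊔ (LieSubmodule.lieSpan R L S).toSubmodule = ⊤ := by
    refine eq_top_of_forall_lie_mem hG (fun g hg ↦ Submodule.mem_sup_left (hGV hg))
      fun g hg u hu ↦ ?_
    obtain ⟨v, hv, w, hw, rfl⟩ := Submodule.mem_sup.1 hu
    rw [lie_add]
    exact Submodule.add_mem _ (hlie g hg v hv)
      (Submodule.mem_sup_right ((LieSubmodule.lieSpan R L S).lie_mem hw))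
  refine LieSubmodule.toSubmodule_injective ?_
  exact eq_of_le_of_inf_le_of_sup_le (show _ ≤ φ.ker.toSubmodule from lieSpan_le)
    (hV.symm.eq_bot.trans_le bot_le) (le_top.trans_eq (by rw [sup_comm, sup_eq_top]))

theorem exists_finset_card_le_lieSpan_eq_ker {G E : Set L} (hG : LieSubalgebra.lieSpan R L G = ⊤)
    {φ : L →ₗ⁅R⁆ L'} (hE : Disjoint (Submodule.span R E) φ.ker.toSubmodule)
    (hGE : G ⊆ Submodule.span R E) (Z : Finset L)
    (hφZ : ∀ z ∈ Z, φ z ∈ (Submodule.span R E).map (φ : L →ₗ[R] L'))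
    (hZ : ∀ g ∈ G, ∀ v ∈ E, ⁅g, v⁆ ∈ Z ∨ ⁅g, v⁆ ∈ Submodule.span R E) :
    ∃ S : Finset L, S.card ≤ Z.card ∧ LieSubmodule.lieSpan R L (S : Set L) = φ.ker := by
  classical
  choose! ρ hρ hφρ using fun z hz ↦ Submodule.mem_map.1 (hφZ z hz)
  refine ⟨Z.image fun z ↦ z - ρ z, Finset.card_image_le, lieSpan_eq_ker hG hE hGE ?_ ?_⟩
  · intro r hr
    obtain ⟨z, hz, rfl⟩ := Finset.mem_image.1 (Finset.mem_coe.1 hr)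
    exact (LieHom.mem_ker).2 (by rw [map_sub, sub_eq_zero]; exact (hφρ z hz).symm)
  · intro g hg v hv
    set I := LieSubmodule.lieSpan R L ((Z.image fun z ↦ z - ρ z : Finset L) : Set L)
    suffices Submodule.span R E ≤
        (Submodule.span R E ⊔ I.toSubmodule).comap (LieAlgebra.ad R L g : L →ₗ[R] L) from this hv
    refine Submodule.span_le.2 fun e he ↦ ?_
    change ⁅g, e⁆ ∈ Submodule.span R E ⊔ I.toSubmodule
    obtain hz | hmem := hZ g hg e he
    · have sub_mem : ⁅g, e⁆ - ρ ⁅g, e⁆ ∈ I := LieSubmodule.subset_lieSpan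
        (Finset.mem_coe.2 (Finset.mem_image_of_mem _ hz))
      rw [← add_sub_cancel (ρ ⁅g, e⁆) ⁅g, e⁆]
      exact Submodule.add_mem_sup (hρ _ hz) sub_mem
    · exact Submodule.mem_sup_left hmem

end Presentation

theorem exists_irredundant_subset_lieSpan_eq {R L M : Type*} [CommRing R] [LieRing L]
    [AddCommGroup M] [Module R M] [LieRingModule L M] (S : Finset M) :
    ∃ T ⊆ S, (∀ r ∈ (T : Set M), r ∉ LieSubmodule.lieSpan R L ((T : Set M) \ {r})) ∧
      LieSubmodule.lieSpan R L (T : Set M) = LieSubmodule.lieSpan R L (S : Set M) := by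
  classical
  obtain ⟨T, hTS, hT, hmin⟩ := exists_minimal_le_of_wellFoundedLT
    (fun T : Finset M ↦ LieSubmodule.lieSpan R L (T : Set M) = LieSubmodule.lieSpan R L S) S rfl
  refine ⟨T, hTS, fun r hr hmem ↦ ?_, hT⟩
  have hspan : LieSubmodule.lieSpan R L ((T.erase r : Finset M) : Set M) =
      LieSubmodule.lieSpan R L (T : Set M) := by
    rw [Finset.coe_erase]
    refine le_antisymm (LieSubmodule.lieSpan_mono Set.sdiff_subset)
      (LieSubmodule.lieSpan_le.2 fun s hs ↦ ?_)
    obtain rfl | hsr := eq_or_ne s r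
    · exact hmem
    · exact LieSubmodule.subset_lieSpan ⟨hs, hsr⟩
  exact Finset.notMem_erase r T (hmin (hspan.trans hT) (T.erase_subset r) hr)

theorem lieSpan_range_of (R X : Type*) [CommRing R] :
    LieSubalgebra.lieSpan R (FreeLieAlgebra R X) (Set.range (FreeLieAlgebra.of R)) = ⊤ := by
  set K := LieSubalgebra.lieSpan R (FreeLieAlgebra R X) (Set.range (FreeLieAlgebra.of R))
  let toK : FreeLieAlgebra R X →ₗ⁅R⁆ K := FreeLieAlgebra.lift R fun x ↦
    ⟨FreeLieAlgebra.of R x, LieSubalgebra.subset_lieSpan ⟨x, rfl⟩⟩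
  have incl_comp_toK : K.incl.comp toK = LieHom.id := FreeLieAlgebra.hom_ext fun x ↦ by simp [toK]
  refine eq_top_iff.2 fun z _ ↦ ?_
  have coe_toK : (toK z : FreeLieAlgebra R X) = z := LieHom.congr_fun incl_comp_toK z
  exact coe_toK ▸ (toK z).2

section Words

variable {L L' : Type*} [LieRing L] [LieRing L']

/-- The Lie monomial `(ad Y)ʲ (ad X)ⁱ Y`. -/
def adWord (X Y : L) (i j : ℕ) : L :=
  (⁅Y, ·⁆)^[j] ((⁅X, ·⁆)^[i] Y)

theorem lie_right_adWord (X Y : L) (i j : ℕ) : ⁅Y, adWord X Y i j⁆ = adWord X Y i (j + 1) :=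
  (Function.iterate_succ_apply' _ _ _).symm

theorem lie_left_adWord_zero (X Y : L) (i : ℕ) : ⁅X, adWord X Y i 0⁆ = adWord X Y (i + 1) 0 :=
  (Function.iterate_succ_apply' (⁅X, ·⁆) i Y).symm

theorem lie_left_adWord_one_one (X Y : L) : ⁅X, adWord X Y 1 1⁆ = adWord X Y 2 1 :=
  calc ⁅X, ⁅Y, ⁅X, Y⁆⁆⁆ = ⁅⁅X, Y⁆, ⁅X, Y⁆⁆ + ⁅Y, ⁅X, ⁅X, Y⁆⁆⁆ := leibniz_lie X Y ⁅X, Y⁆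
    _ = ⁅Y, ⁅X, ⁅X, Y⁆⁆⁆ := by rw [lie_self, zero_add]

theorem map_adWord {R : Type*} [CommRing R] [LieAlgebra R L] [LieAlgebra R L'] (φ : L →ₗ⁅R⁆ L')
    (X Y : L) (i j : ℕ) : φ (adWord X Y i j) = adWord (φ X) (φ Y) i j := by
  have semiconj_lie (Z : L) : Function.Semiconj φ (⁅Z, ·⁆) (⁅φ Z, ·⁆) := fun W ↦ φ.map_lie Z W
  simp only [adWord, (semiconj_lie Y).iterate_right j _, (semiconj_lie X).iterate_right i _]

end Words

section QCommuting

variable {R A : Type*} [CommRing R] [Ring A] [Algebra R A] {q : R} {x y : A}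

theorem mul_pow_of_semiconjBy (h : SemiconjBy y x (q • x)) (i : ℕ) :
    y * x ^ i = q ^ i • (x ^ i * y) := by
  rw [(h.pow_right i).eq, smul_pow, smul_mul_assoc]

theorem pow_mul_of_semiconjBy (h : SemiconjBy y x (q • x)) (j : ℕ) :
    y ^ j * x = q ^ j • (x * y ^ j) := by
  induction j with
  | zero => simp
  | succ j ih =>
    rw [pow_succ, mul_assoc, h.eq, smul_mul_assoc, mul_smul_comm, ← mul_assoc, ih, smul_mul_assoc,
      smul_smul, ← pow_succ', mul_assoc]

theorem lie_left_pow_mul_pow (h : SemiconjBy y x (q • x)) (i j : ℕ) :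
    ⁅x, x ^ i * y ^ j⁆ = (1 - q ^ j) • (x ^ (i + 1) * y ^ j) := by
  rw [Ring.lie_def, mul_assoc _ (y ^ j), pow_mul_of_semiconjBy h, mul_smul_comm, ← mul_assoc,
    ← mul_assoc, ← pow_succ, ← pow_succ', sub_smul, one_smul]

theorem lie_right_pow_mul_pow (h : SemiconjBy y x (q • x)) (i j : ℕ) :
    ⁅y, x ^ i * y ^ j⁆ = (q ^ i - 1) • (x ^ i * y ^ (j + 1)) := by
  rw [Ring.lie_def, ← mul_assoc, mul_pow_of_semiconjBy h, smul_mul_assoc, mul_assoc, mul_assoc,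
    ← pow_succ, ← pow_succ', sub_smul, one_smul]

theorem adWord_eq_smul_pow_mul_pow (h : SemiconjBy y x (q • x)) (i j : ℕ) :
    adWord x y i j = ((q ^ i - 1) ^ j * (1 - q) ^ i) • (x ^ i * y ^ (j + 1)) := by
  induction j with
  | zero =>
    induction i with
    | zero => simp [adWord]
    | succ i ih =>
      rw [← lie_left_adWord_zero, ih, LieAlgebra.lie_smul, lie_left_pow_mul_pow h, smul_smul]
      simp only [pow_zero, one_mul, zero_add, pow_one, ← pow_succ]
  | succ j ih =>
    rw [← lie_right_adWord, ih, LieAlgebra.lie_smul, lie_right_pow_mul_pow h, smul_smul]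
    ring_nf

end QCommuting

theorem eq_zero_of_sum_eq_zero_of_forall_map_eq_smul {K V ι : Type*} [CommRing K] [IsDomain K]
    [AddCommGroup V] [Module K V] [Module.IsTorsionFree K V] {s : Finset ι} (T : V →ₗ[K] V)
    {μ : ι → K} (hμ : Set.InjOn μ s) {v : ι → V} (hv : ∀ i ∈ s, T (v i) = μ i • v i)
    (hsum : ∑ i ∈ s, v i = 0) : ∀ i ∈ s, v i = 0 := by
  intro i hi
  have indep : iSupIndep fun i : s ↦ Module.End.eigenspace T (μ i) :=
    (Module.End.eigenspaces_iSupIndep T).comp hμ.injective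
  exact (iSupIndep_iff_finsetSum_eq_zero_imp_eq_zero _).1 indep Finset.univ (fun i ↦ v i)
    (fun i _ ↦ Module.End.mem_eigenspace_iff.2 (hv i i.2))
    ((Finset.sum_coe_sort s v).trans hsum) ⟨i, hi⟩ (Finset.mem_univ _)

/-- A *Weyl pair* of order `n`: elements `x`, `y` with `xⁿ = yⁿ = 1` which commute up to the
primitive `n`-th root of unity `a`. The clock and shift matrices are the motivating example. -/
structure IsWeylPair {K A : Type*} [CommRing K] [Ring A] [Algebra K A] (n : ℕ) (a : K) (x y : A) :
    Prop where
  isPrimitiveRoot : IsPrimitiveRoot a n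
  left_pow_eq_one : x ^ n = 1
  right_pow_eq_one : y ^ n = 1
  semiconjBy : SemiconjBy y x (a • x)

/-- The exponents `(i, j)` of the monomials `xⁱ yʲ⁺¹` of a Weyl pair, one for each monomial
different from `1 = x⁰ yⁿ`. -/
def weylIndex (n : ℕ) : Finset (ℕ × ℕ) :=
  (Finset.range n ×ˢ Finset.range n).erase (0, n - 1)

theorem mem_weylIndex {n i j : ℕ} :
    (i, j) ∈ weylIndex n ↔ i < n ∧ j < n ∧ ¬(i = 0 ∧ j = n - 1) := by
  simp only [weylIndex, Finset.mem_erase, Finset.mem_product, Finset.mem_range, ne_eq,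
    Prod.mk.injEq]
  tauto

theorem card_weylIndex {n : ℕ} (hn : n ≠ 0) : (weylIndex n).card = n ^ 2 - 1 := by
  have last_mem : (0, n - 1) ∈ Finset.range n ×ˢ Finset.range n := by
    simp only [Finset.mem_product, Finset.mem_range]
    omega
  rw [weylIndex, Finset.card_erase_of_mem last_mem, Finset.card_product, Finset.card_range, sq]

/-- The monomial `xⁱ yʲ⁺¹` for `p = (i, j)`; the shift makes `y` itself the first monomial. -/
def weylMonomial {A : Type*} [Ring A] (x y : A) (p : ℕ × ℕ) : A :=
  x ^ p.1 * y ^ (p.2 + 1)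

/-- The span of the monomials of a Weyl pair of order `n` other than `1`. -/
def weylSpan (K : Type*) {A : Type*} [CommRing K] [Ring A] [Algebra K A] (n : ℕ) (x y : A) :
    Submodule K A :=
  Submodule.span K (weylMonomial x y '' weylIndex n)

namespace IsWeylPair

variable {K A : Type*} [Field K] [Ring A] [Algebra K A] {n : ℕ} {a : K} {x y : A}

theorem one_sub_pow_ne_zero (h : IsWeylPair n a x y) {k : ℕ} (hk : k ≠ 0) (hkn : k < n) :
    1 - a ^ k ≠ 0 :=
  sub_ne_zero.2 (h.isPrimitiveRoot.pow_ne_one_of_pos_of_lt hk hkn).symm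

theorem right_conj_weylMonomial (h : IsWeylPair n a x y) (hn : n ≠ 0) (p : ℕ × ℕ) :
    y * weylMonomial x y p * y ^ (n - 1) = a ^ p.1 • weylMonomial x y p := by
  rw [weylMonomial, ← mul_assoc, mul_pow_of_semiconjBy h.semiconjBy, smul_mul_assoc,
    smul_mul_assoc, mul_assoc, mul_assoc, ← pow_add, ← pow_succ',
    show p.2 + 1 + (n - 1) + 1 = p.2 + 1 + n by omega, pow_add, h.right_pow_eq_one, mul_one]

theorem left_conj_weylMonomial (h : IsWeylPair n a x y) (hn : n ≠ 0) (p : ℕ × ℕ) :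
    x ^ (n - 1) * weylMonomial x y p * x = a ^ (p.2 + 1) • weylMonomial x y p := by
  rw [weylMonomial, mul_assoc, mul_assoc, pow_mul_of_semiconjBy h.semiconjBy, mul_smul_comm,
    mul_smul_comm, ← mul_assoc (x ^ p.1), ← pow_succ, ← mul_assoc, ← pow_add,
    show n - 1 + (p.1 + 1) = n + p.1 by omega, pow_add x, h.left_pow_eq_one, one_mul]

theorem isUnit_weylMonomial (h : IsWeylPair n a x y) (hn : n ≠ 0) (p : ℕ × ℕ) :
    IsUnit (weylMonomial x y p) :=
  ((IsUnit.of_pow_eq_one h.left_pow_eq_one hn).pow _).mul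
    ((IsUnit.of_pow_eq_one h.right_pow_eq_one hn).pow _)

theorem injOn_pow (h : IsWeylPair n a x y) : Set.InjOn (a ^ ·) (Finset.range n) :=
  fun _ hi _ hj hij ↦
    h.isPrimitiveRoot.pow_inj (Finset.mem_range.1 hi) (Finset.mem_range.1 hj) hij

theorem injOn_pow_succ (h : IsWeylPair n a x y) (hn : n ≠ 0) :
    Set.InjOn (fun j ↦ a ^ (j + 1)) (Finset.range n) := fun i hi j hj hij ↦
  h.injOn_pow hi hj (mul_right_cancel₀ (h.isPrimitiveRoot.ne_zero hn)
    (by simpa only [← pow_succ] using hij))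

/- Conjugation by `y` separates the exponents of `x`, conjugation by `x` those of `y`. -/
theorem linearIndepOn_weylMonomial [Nontrivial A] (h : IsWeylPair n a x y) (hn : n ≠ 0) :
    LinearIndepOn K (weylMonomial x y) (Finset.range n ×ˢ Finset.range n : Finset (ℕ × ℕ)) := by
  rw [linearIndepOn_finset_iff]
  intro c hc
  rw [Finset.sum_product] at hc
  have inner_sum_eq_zero := eq_zero_of_sum_eq_zero_of_forall_map_eq_smul
    (LinearMap.mulLeftRight K (y, y ^ (n - 1))) h.injOn_pow (fun i _ ↦ by
      simp only [map_sum, map_smul, LinearMap.mulLeftRight_apply, h.right_conj_weylMonomial hn,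
        Finset.smul_sum, smul_comm (c _)]) hc
  rintro ⟨i, j⟩ hij
  rw [Finset.mem_product] at hij
  have term_eq_zero := eq_zero_of_sum_eq_zero_of_forall_map_eq_smul
    (LinearMap.mulLeftRight K (x ^ (n - 1), x)) (h.injOn_pow_succ hn) (fun j _ ↦ by
      rw [map_smul, LinearMap.mulLeftRight_apply, h.left_conj_weylMonomial hn, smul_comm])
    (inner_sum_eq_zero i hij.1) j hij.2
  exact (smul_eq_zero.1 term_eq_zero).resolve_right (h.isUnit_weylMonomial hn _).ne_zero

theorem linearIndepOn_weylIndex [Nontrivial A] (h : IsWeylPair n a x y) (hn : n ≠ 0) :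
    LinearIndepOn K (weylMonomial x y) (weylIndex n) :=
  (h.linearIndepOn_weylMonomial hn).mono (Finset.coe_subset.2 (Finset.erase_subset _ _))

theorem finrank_weylSpan [Nontrivial A] (h : IsWeylPair n a x y) (hn : n ≠ 0) :
    Module.finrank K (weylSpan K n x y) = n ^ 2 - 1 := by
  rw [weylSpan, Set.image_eq_range,
    finrank_span_eq_card (h.linearIndepOn_weylIndex hn).linearIndependent, ← card_weylIndex hn]
  exact Fintype.card_coe _

theorem pow_mul_pow_mem_weylSpan (h : IsWeylPair n a x y) (hn : n ≠ 0) {i j : ℕ}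
    (hij : ¬(n ∣ i ∧ n ∣ j)) : x ^ i * y ^ j ∈ weylSpan K n x y := by
  have hi : i % n < n := Nat.mod_lt i (Nat.pos_of_ne_zero hn)
  have hj : j % n < n := Nat.mod_lt j (Nat.pos_of_ne_zero hn)
  rw [Nat.dvd_iff_mod_eq_zero, Nat.dvd_iff_mod_eq_zero] at hij
  rw [pow_eq_pow_mod i h.left_pow_eq_one, pow_eq_pow_mod j h.right_pow_eq_one]
  obtain hj0 | hj0 := eq_or_ne (j % n) 0
  · refine Submodule.subset_span ⟨(i % n, n - 1), mem_weylIndex.2 (by omega), ?_⟩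
    rw [weylMonomial, Nat.sub_one_add_one hn, h.right_pow_eq_one, hj0, pow_zero]
  · refine Submodule.subset_span ⟨(i % n, j % n - 1), mem_weylIndex.2 (by omega), ?_⟩
    rw [weylMonomial, Nat.sub_one_add_one hj0]

theorem left_mem_weylSpan (h : IsWeylPair n a x y) (hn : 2 ≤ n) : x ∈ weylSpan K n x y := by
  simpa using h.pow_mul_pow_mem_weylSpan (i := 1) (j := 0) (by omega)
    fun hdvd ↦ by have := Nat.le_of_dvd one_pos hdvd.1; omega

theorem right_mem_weylSpan (h : IsWeylPair n a x y) (hn : 2 ≤ n) : y ∈ weylSpan K n x y := by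
  simpa using h.pow_mul_pow_mem_weylSpan (i := 0) (j := 1) (by omega)
    fun hdvd ↦ by have := Nat.le_of_dvd one_pos hdvd.2; omega

theorem lie_left_mem_weylSpan (h : IsWeylPair n a x y) (hn : n ≠ 0) {z : A}
    (hz : z ∈ weylSpan K n x y) : ⁅x, z⁆ ∈ weylSpan K n x y := by
  suffices weylSpan K n x y ≤ (weylSpan K n x y).comap (LieAlgebra.ad K A x) from this hz
  refine Submodule.span_le.2 ?_
  rintro _ ⟨p, -, rfl⟩
  change ⁅x, x ^ p.1 * y ^ (p.2 + 1)⁆ ∈ weylSpan K n x y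
  rw [lie_left_pow_mul_pow h.semiconjBy]
  by_cases hdvd : n ∣ p.2 + 1
  · rw [(h.isPrimitiveRoot.pow_eq_one_iff_dvd _).2 hdvd, sub_self, zero_smul]
    exact zero_mem _
  · exact Submodule.smul_mem _ _ (h.pow_mul_pow_mem_weylSpan hn fun hdvd' ↦ hdvd hdvd'.2)

theorem lie_right_mem_weylSpan (h : IsWeylPair n a x y) (hn : n ≠ 0) {z : A}
    (hz : z ∈ weylSpan K n x y) : ⁅y, z⁆ ∈ weylSpan K n x y := by
  suffices weylSpan K n x y ≤ (weylSpan K n x y).comap (LieAlgebra.ad K A y) from this hz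
  refine Submodule.span_le.2 ?_
  rintro _ ⟨p, -, rfl⟩
  change ⁅y, x ^ p.1 * y ^ (p.2 + 1)⁆ ∈ weylSpan K n x y
  rw [lie_right_pow_mul_pow h.semiconjBy]
  by_cases hdvd : n ∣ p.1
  · rw [(h.isPrimitiveRoot.pow_eq_one_iff_dvd _).2 hdvd, sub_self, zero_smul]
    exact zero_mem _
  · exact Submodule.smul_mem _ _ (h.pow_mul_pow_mem_weylSpan hn fun hdvd' ↦ hdvd hdvd'.1)

end IsWeylPair

section WeylLift

variable {L : Type*} [LieRing L] {n i j : ℕ} {X Y : L}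

/-- A Lie polynomial in `X`, `Y` whose value at a Weyl pair of order `n` is a nonzero multiple of
`weylMonomial x y p`, for `p ∈ weylIndex n`. -/
def weylLift (n : ℕ) (X Y : L) (p : ℕ × ℕ) : L :=
  if p = (1, n - 1) then X
  else if p.1 = 0 ∧ p.2 ≠ 0 then ⁅X, adWord X Y (n - 1) p.2⁆
  else adWord X Y p.1 p.2

theorem weylLift_one_last : weylLift n X Y (1, n - 1) = X :=
  if_pos rfl

theorem weylLift_zero_left (hj : j ≠ 0) : weylLift n X Y (0, j) = ⁅X, adWord X Y (n - 1) j⁆ := by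
  simp [weylLift, hj]

theorem weylLift_eq_adWord (h1 : (i, j) ≠ (1, n - 1)) (h0 : i = 0 → j = 0) :
    weylLift n X Y (i, j) = adWord X Y i j := by
  rw [weylLift, if_neg h1, if_neg (by tauto)]

theorem map_weylLift {R L' : Type*} [CommRing R] [LieAlgebra R L] [LieRing L'] [LieAlgebra R L']
    (φ : L →ₗ⁅R⁆ L') (n : ℕ) (X Y : L) (p : ℕ × ℕ) :
    φ (weylLift n X Y p) = weylLift n (φ X) (φ Y) p := by
  simp only [weylLift, apply_ite φ, LieHom.map_lie, map_adWord]

/-- The span of the lifts of the monomials of a Weyl pair of order `n` other than `1`. -/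
def liftSpan (R : Type*) [CommRing R] [LieAlgebra R L] (n : ℕ) (X Y : L) : Submodule R L :=
  Submodule.span R (weylLift n X Y '' weylIndex n)

/-- The exponents `p` for which `⁅X, weylLift n X Y p⁆` contributes a relation. The Jacobi identity
`⁅X, ⁅Y, ⁅X, Y⁆⁆⁆ = ⁅Y, ⁅X, ⁅X, Y⁆⁆⁆` saves the relation with `p = (1, 1)`. -/
def leftRelationIndex (n : ℕ) : Finset (ℕ × ℕ) :=
  (Finset.range (n - 1) ×ˢ Finset.Icc 1 (n - 2)).erase (1, 1) ∪
    insert (n - 1, 0) (Finset.Icc 2 (n - 1) ×ˢ {n - 1})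

/-- The exponents `p` for which `⁅Y, weylLift n X Y p⁆` contributes a relation. -/
def rightRelationIndex (n : ℕ) : Finset (ℕ × ℕ) :=
  {0} ×ˢ Finset.Icc 1 (n - 2) ∪ insert (1, n - 2) (Finset.Icc 2 (n - 1) ×ˢ {n - 1})

theorem card_leftRelationIndex_add_card_rightRelationIndex_le {n : ℕ} (hn : 2 ≤ n) :
    (leftRelationIndex n).card + (rightRelationIndex n).card ≤ max 2 (n ^ 2 - 3) := by
  obtain ⟨k, rfl⟩ := Nat.exists_eq_add_of_le' hn
  have card_insert_le (p : ℕ × ℕ) :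
      (insert p (Finset.Icc 2 (k + 1) ×ˢ {k + 1})).card ≤ k + 1 :=
    (Finset.card_insert_le _ _).trans (by simp)
  have card_erase_le : ((Finset.range (k + 1) ×ˢ Finset.Icc 1 k).erase (1, 1)).card ≤
      (k + 1) * k - 1 := by
    obtain rfl | hk := Nat.eq_zero_or_pos k
    · simp
    · rw [Finset.card_erase_of_mem (Finset.mem_product.2 ⟨Finset.mem_range.2 (by omega),
        Finset.mem_Icc.2 (by omega)⟩)]
      simp
  have left_le : (leftRelationIndex (k + 2)).card ≤ (k + 1) * k - 1 + (k + 1) :=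
    (Finset.card_union_le _ _).trans (add_le_add card_erase_le (card_insert_le _))
  have right_le : (rightRelationIndex (k + 2)).card ≤ k + (k + 1) :=
    (Finset.card_union_le _ _).trans (add_le_add (by simp) (card_insert_le _))
  have sq_eq : (k + 2) ^ 2 = (k + 1) * k + 3 * k + 4 := by ring
  have pos_or : k = 0 ∨ 1 ≤ (k + 1) * k := by
    rcases Nat.eq_zero_or_pos k with hk | hk
    · exact .inl hk
    · exact .inr (Nat.mul_pos k.succ_pos hk)
  have := le_max_left 2 ((k + 2) ^ 2 - 3)
  have := le_max_right 2 ((k + 2) ^ 2 - 3)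
  omega

variable {R : Type*} [CommRing R] [LieAlgebra R L]

theorem weylLift_mem_liftSpan {p : ℕ × ℕ} (hp : p ∈ weylIndex n) :
    weylLift n X Y p ∈ liftSpan R n X Y :=
  Submodule.subset_span ⟨p, hp, rfl⟩

theorem adWord_mem_liftSpan (hij : (i, j) ∈ weylIndex n) (h1 : (i, j) ≠ (1, n - 1))
    (h0 : i = 0 → j = 0) : adWord X Y i j ∈ liftSpan R n X Y := by
  rw [← weylLift_eq_adWord h1 h0]
  exact weylLift_mem_liftSpan hij

theorem left_mem_liftSpan (hn : 2 ≤ n) : X ∈ liftSpan R n X Y :=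
  Submodule.subset_span ⟨(1, n - 1), mem_weylIndex.2 (by omega), weylLift_one_last⟩

theorem right_mem_liftSpan (hn : 2 ≤ n) : Y ∈ liftSpan R n X Y :=
  adWord_mem_liftSpan (i := 0) (j := 0) (mem_weylIndex.2 (by omega)) (by simp) fun _ ↦ rfl

theorem lie_left_weylLift_mem_liftSpan (hn : 2 ≤ n) (hij : (i, j) ∈ weylIndex n)
    (hrel : (i, j) ∉ leftRelationIndex n) : ⁅X, weylLift n X Y (i, j)⁆ ∈ liftSpan R n X Y := by
  rw [mem_weylIndex] at hij
  simp only [leftRelationIndex, Finset.mem_union, Finset.mem_erase, Finset.mem_product,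
    Finset.mem_range, Finset.mem_Icc, Finset.mem_insert, Finset.mem_singleton, ne_eq,
    Prod.mk.injEq] at hrel
  obtain ⟨rfl, rfl⟩ | ⟨rfl, hi⟩ | ⟨rfl, hj, hjn⟩ | ⟨rfl, rfl, hn3⟩ :
      i = 1 ∧ j = n - 1 ∨ j = 0 ∧ i + 1 < n ∨ i = n - 1 ∧ j ≠ 0 ∧ j + 1 < n ∨
        i = 1 ∧ j = 1 ∧ 2 < n := by omega
  · rw [weylLift_one_last, lie_self]
    exact zero_mem _
  · rw [weylLift_eq_adWord (by grind) (by omega), lie_left_adWord_zero]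
    exact adWord_mem_liftSpan (mem_weylIndex.2 (by omega)) (by grind) (by omega)
  · rw [weylLift_eq_adWord (by grind) (by omega), ← weylLift_zero_left hj]
    exact weylLift_mem_liftSpan (mem_weylIndex.2 (by omega))
  · rw [weylLift_eq_adWord (by grind) (by omega), lie_left_adWord_one_one]
    exact adWord_mem_liftSpan (mem_weylIndex.2 (by omega)) (by grind) (by omega)

theorem lie_right_weylLift_mem_liftSpan (hn : 2 ≤ n) (hij : (i, j) ∈ weylIndex n)
    (hrel : (i, j) ∉ rightRelationIndex n) : ⁅Y, weylLift n X Y (i, j)⁆ ∈ liftSpan R n X Y := by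
  rw [mem_weylIndex] at hij
  simp only [rightRelationIndex, Finset.mem_union, Finset.mem_product, Finset.mem_Icc,
    Finset.mem_insert, Finset.mem_singleton, Prod.mk.injEq] at hrel
  obtain ⟨rfl, rfl⟩ | ⟨rfl, rfl⟩ | ⟨hi, hj, hij1⟩ :
      i = 1 ∧ j = n - 1 ∨ i = 0 ∧ j = 0 ∨
        i ≠ 0 ∧ j + 1 < n ∧ ¬(i = 1 ∧ j + 1 = n - 1) := by omega
  · rw [weylLift_one_last, ← lie_skew]
    exact neg_mem (adWord_mem_liftSpan (i := 1) (j := 0) (mem_weylIndex.2 (by omega))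
      (by grind) (by omega))
  · rw [weylLift_eq_adWord (by simp) (by simp)]
    exact (lie_self Y).symm ▸ zero_mem _
  · rw [weylLift_eq_adWord (by grind) (by omega), lie_right_adWord]
    exact adWord_mem_liftSpan (mem_weylIndex.2 (by omega)) (by grind) (by omega)

end WeylLift

namespace IsWeylPair

variable {K A L : Type*} [Field K] [Ring A] [Algebra K A] [LieRing L] [LieAlgebra K L]
  {n : ℕ} {a : K} {x y : A}

theorem exists_adWord_eq_smul (h : IsWeylPair n a x y) {i j : ℕ} (hin : i < n)
    (hij : i = 0 → j = 0) (hn : 2 ≤ n) :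
    ∃ c : Kˣ, adWord x y i j = c • weylMonomial x y (i, j) := by
  have left_ne_zero : (a ^ i - 1) ^ j ≠ 0 := by
    obtain rfl | hi := eq_or_ne i 0
    · simp [hij rfl]
    · exact pow_ne_zero j (sub_ne_zero.2 (h.isPrimitiveRoot.pow_ne_one_of_pos_of_lt hi hin))
  have right_ne_zero : (1 - a) ^ i ≠ 0 :=
    pow_ne_zero i (by simpa using h.one_sub_pow_ne_zero one_ne_zero hn)
  exact ⟨Units.mk0 _ (mul_ne_zero left_ne_zero right_ne_zero),
    adWord_eq_smul_pow_mul_pow h.semiconjBy i j⟩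

theorem exists_weylLift_eq_smul (h : IsWeylPair n a x y) (hn : 2 ≤ n) {p : ℕ × ℕ}
    (hp : p ∈ weylIndex n) : ∃ c : Kˣ, weylLift n x y p = c • weylMonomial x y p := by
  obtain ⟨i, j⟩ := p
  have hij := mem_weylIndex.1 hp
  by_cases h1 : (i, j) = (1, n - 1)
  · refine ⟨1, ?_⟩
    rw [h1, weylLift_one_last, weylMonomial, Nat.sub_one_add_one (by omega), h.right_pow_eq_one]
    simp
  by_cases h0 : i = 0 ∧ j ≠ 0
  · obtain ⟨rfl, hj⟩ := h0
    obtain ⟨c, hc⟩ := h.exists_adWord_eq_smul (i := n - 1) (j := j) (by omega) (by omega) hn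
    refine ⟨c * Units.mk0 _ (h.one_sub_pow_ne_zero (k := j + 1) (by omega) (by omega)), ?_⟩
    rw [weylLift_zero_left hj, hc, Units.smul_def, LieAlgebra.lie_smul, weylMonomial,
      lie_left_pow_mul_pow h.semiconjBy, Nat.sub_one_add_one (by omega), h.left_pow_eq_one,
      mul_smul, Units.smul_def, Units.smul_mk0, weylMonomial, pow_zero]
  · rw [weylLift_eq_adWord h1 (by tauto)]
    exact h.exists_adWord_eq_smul hij.1 (by tauto) hn

theorem liftSpan_eq_weylSpan (h : IsWeylPair n a x y) (hn : 2 ≤ n) :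
    liftSpan K n x y = weylSpan K n x y := by
  refine le_antisymm (Submodule.span_le.2 ?_) (Submodule.span_le.2 ?_) <;> rintro _ ⟨p, hp, rfl⟩ <;>
    obtain ⟨c, hc⟩ := h.exists_weylLift_eq_smul hn hp
  · exact hc ▸ Submodule.smul_mem _ (c : K) (Submodule.subset_span ⟨p, hp, rfl⟩)
  · exact (eq_inv_smul_iff.2 hc.symm) ▸
      Submodule.smul_mem _ ((c⁻¹ : Kˣ) : K) (Submodule.subset_span ⟨p, hp, rfl⟩)

theorem linearIndepOn_weylLift [Nontrivial A] (h : IsWeylPair n a x y) (hn : 2 ≤ n) :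
    LinearIndepOn K (weylLift n x y) (weylIndex n) := by
  choose c hc using fun p : weylIndex n ↦ h.exists_weylLift_eq_smul hn p.2
  have weylLift_eq : (fun p : weylIndex n ↦ weylLift n x y p) =
      c • fun p : weylIndex n ↦ weylMonomial x y p :=
    funext hc
  change LinearIndependent K fun p : weylIndex n ↦ weylLift n x y p
  rw [weylLift_eq]
  exact (h.linearIndepOn_weylIndex (by omega)).linearIndependent.units_smul c

variable {X Y : L} (φ : L →ₗ⁅K⁆ A)

theorem map_liftSpan (h : IsWeylPair n a (φ X) (φ Y)) (hn : 2 ≤ n) :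
    (liftSpan K n X Y).map (φ : L →ₗ[K] A) = weylSpan K n (φ X) (φ Y) := by
  rw [← h.liftSpan_eq_weylSpan hn, liftSpan, liftSpan, Submodule.map_span, ← Set.image_comp]
  exact congrArg _ (Set.image_congr fun p _ ↦ map_weylLift φ n X Y p)

theorem disjoint_liftSpan_ker [Nontrivial A] (h : IsWeylPair n a (φ X) (φ Y)) (hn : 2 ≤ n) :
    Disjoint (liftSpan K n X Y) φ.ker.toSubmodule := by
  rw [liftSpan, Set.image_eq_range]
  refine Submodule.range_ker_disjoint (f := (φ : L →ₗ[K] A)) ?_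
  have map_eq : (φ : L →ₗ[K] A) ∘ (fun p : weylIndex n ↦ weylLift n X Y p) =
      fun p : weylIndex n ↦ weylLift n (φ X) (φ Y) p := funext fun p ↦ map_weylLift φ n X Y p
  exact map_eq ▸ (h.linearIndepOn_weylLift hn).linearIndependent

theorem range_eq_weylSpan (h : IsWeylPair n a (φ X) (φ Y)) (hn : 2 ≤ n)
    (hXY : LieSubalgebra.lieSpan K L {X, Y} = ⊤) :
    φ.range.toSubmodule = weylSpan K n (φ X) (φ Y) := by
  have comap_eq_top : (weylSpan K n (φ X) (φ Y)).comap (φ : L →ₗ[K] A) = ⊤ := by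
    refine eq_top_of_forall_lie_mem hXY ?_ ?_
    · rintro _ (rfl | rfl)
      exacts [h.left_mem_weylSpan hn, h.right_mem_weylSpan hn]
    · rintro _ (rfl | rfl) u hu <;> change φ ⁅_, u⁆ ∈ weylSpan K n _ _ <;> rw [φ.map_lie]
      exacts [h.lie_left_mem_weylSpan (by omega) hu, h.lie_right_mem_weylSpan (by omega) hu]
  refine le_antisymm ?_ ?_
  · rintro _ ⟨z, rfl⟩
    exact (comap_eq_top ▸ Submodule.mem_top : z ∈ (weylSpan K n (φ X) (φ Y)).comap (φ : L →ₗ[K] A))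
  · rw [← h.map_liftSpan φ hn]
    exact LinearMap.map_le_range

theorem exists_finset_lieSpan_eq_ker [Nontrivial A] (h : IsWeylPair n a (φ X) (φ Y)) (hn : 2 ≤ n)
    (hXY : LieSubalgebra.lieSpan K L {X, Y} = ⊤) :
    ∃ S : Finset L, S.card ≤ max 2 (n ^ 2 - 3) ∧
      LieSubmodule.lieSpan K L (S : Set L) = φ.ker := by
  classical
  let Z := (leftRelationIndex n).image (fun p ↦ ⁅X, weylLift n X Y p⁆) ∪
    (rightRelationIndex n).image (fun p ↦ ⁅Y, weylLift n X Y p⁆)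
  have card_Z_le : Z.card ≤ max 2 (n ^ 2 - 3) :=
    (Finset.card_union_le _ _).trans <| (add_le_add Finset.card_image_le Finset.card_image_le).trans
      (card_leftRelationIndex_add_card_rightRelationIndex_le hn)
  have map_mem (z : L) : φ z ∈ (liftSpan K n X Y).map (φ : L →ₗ[K] A) := by
    rw [h.map_liftSpan φ hn, ← h.range_eq_weylSpan φ hn hXY]
    exact ⟨z, rfl⟩
  obtain ⟨S, hSZ, hS⟩ := exists_finset_card_le_lieSpan_eq_ker hXY (h.disjoint_liftSpan_ker φ hn)
    (by rintro _ (rfl | rfl); exacts [left_mem_liftSpan hn, right_mem_liftSpan hn]) Z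
    (fun z _ ↦ map_mem z) (by
      rintro _ (rfl | rfl) _ ⟨⟨i, j⟩, hij, rfl⟩
      · by_cases hrel : (i, j) ∈ leftRelationIndex n
        · exact .inl (Finset.mem_union_left _ (Finset.mem_image_of_mem _ hrel))
        · exact .inr (lie_left_weylLift_mem_liftSpan hn hij hrel)
      · by_cases hrel : (i, j) ∈ rightRelationIndex n
        · exact .inl (Finset.mem_union_right _ (Finset.mem_image_of_mem _ hrel))
        · exact .inr (lie_right_weylLift_mem_liftSpan hn hij hrel))
  exact ⟨S, hSZ.trans card_Z_le, hS⟩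

end IsWeylPair

section SpecialLinear

variable {K ι : Type*} [Field K] [Fintype ι] [DecidableEq ι]

theorem finrank_sl_add_one [Nonempty ι] :
    Module.finrank K (LieAlgebra.SpecialLinear.sl ι K) + 1 = Fintype.card ι ^ 2 := by
  have rank_nullity := (Matrix.traceLinearMap ι K K).finrank_range_add_finrank_ker
  rw [LinearMap.range_eq_top.2 Matrix.trace_surjective, finrank_top, Module.finrank_self,
    Module.finrank_matrix, Module.finrank_self, mul_one, ← sq, add_comm] at rank_nullity
  exact rank_nullity

theorem trace_eq_zero_of_mul_mul_eq_smul {u v z : Matrix ι ι K} {c : K} (hvu : v * u = 1)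
    (hc : c ≠ 1) (h : u * z * v = c • z) : z.trace = 0 := by
  have mul_trace_eq : c * z.trace = z.trace :=
    calc c * z.trace = (u * z * v).trace := by rw [h, Matrix.trace_smul, smul_eq_mul]
      _ = z.trace := by rw [Matrix.trace_mul_comm, ← mul_assoc, hvu, one_mul]
  have sub_mul_trace_eq : (c - 1) * z.trace = 0 := by rw [sub_mul, one_mul, mul_trace_eq, sub_self]
  exact (mul_eq_zero.1 sub_mul_trace_eq).resolve_left (sub_ne_zero.2 hc)

variable {n : ℕ} {a : K} {x y : Matrix ι ι K}

theorem IsWeylPair.trace_weylMonomial_eq_zero (h : IsWeylPair n a x y) {p : ℕ × ℕ}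
    (hp : p ∈ weylIndex n) : (weylMonomial x y p).trace = 0 := by
  have hp' := mem_weylIndex.1 hp
  have hn : n ≠ 0 := by omega
  by_cases hp0 : p.1 = 0
  · exact trace_eq_zero_of_mul_mul_eq_smul (by rw [mul_pow_sub_one hn, h.left_pow_eq_one])
      (h.isPrimitiveRoot.pow_ne_one_of_pos_of_lt (by omega) (by omega))
      (h.left_conj_weylMonomial hn p)
  · exact trace_eq_zero_of_mul_mul_eq_smul (by rw [pow_sub_one_mul hn, h.right_pow_eq_one])
      (h.isPrimitiveRoot.pow_ne_one_of_pos_of_lt hp0 (by omega)) (h.right_conj_weylMonomial hn p)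

theorem IsWeylPair.weylSpan_eq_sl [Nonempty ι] (h : IsWeylPair n a x y)
    (hn : n = Fintype.card ι) :
    weylSpan K n x y = (LieAlgebra.SpecialLinear.sl ι K).toSubmodule := by
  subst hn
  refine Submodule.eq_of_le_of_finrank_eq (Submodule.span_le.2 ?_) ?_
  · rintro _ ⟨p, hp, rfl⟩
    exact h.trace_weylMonomial_eq_zero hp
  · rw [h.finrank_weylSpan Fintype.card_ne_zero, ← finrank_sl_add_one (K := K)]
    rfl

end SpecialLinear

theorem shift_eq_permMatrix (n : ℕ) : shift n = (finRotate n).permMatrix ℂ := by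
  obtain _ | n := n
  · exact Subsingleton.elim _ _
  ext i j
  simp [shift, Equiv.Perm.permMatrix, PEquiv.toMatrix_apply, Fin.ext_iff, Fin.val_add, eq_comm]

theorem shift_pow_self {n : ℕ} (hn : 2 ≤ n) : shift n ^ n = 1 := by
  have orderOf_finRotate : orderOf (finRotate n) = n := by
    rw [(isCycle_finRotate_of_le hn).orderOf, support_finRotate_of_le hn, Finset.card_univ,
      Fintype.card_fin]
  have finRotate_pow : finRotate n ^ n = 1 := orderOf_dvd_iff_pow_eq_one.1 orderOf_finRotate.dvd
  calc shift n ^ n = Matrix.permMatrixHom (R := ℂ) (finRotate n)⁻¹ ^ n := by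
        rw [shift_eq_permMatrix, Matrix.permMatrixHom_apply, inv_inv]
    _ = 1 := by rw [← map_pow, inv_pow, finRotate_pow, inv_one, map_one]

theorem isPrimitiveRoot_rootA {n : ℕ} (hn : n ≠ 0) : IsPrimitiveRoot (rootA n) n :=
  Complex.isPrimitiveRoot_exp n hn

theorem clock_pow_self {n : ℕ} (hn : n ≠ 0) : clock n ^ n = 1 := by
  rw [clock, Matrix.diagonal_pow, Matrix.diagonal_eq_one]
  funext i
  rw [Pi.pow_apply, ← pow_mul, mul_comm, pow_mul, (isPrimitiveRoot_rootA hn).pow_eq_one, one_pow,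
    Pi.one_apply]

theorem semiconjBy_shift_clock {n : ℕ} (hn : n ≠ 0) :
    SemiconjBy (shift n) (clock n) (rootA n • clock n) := by
  ext i j
  simp only [clock, shift, Matrix.mul_diagonal, Matrix.smul_mul, Matrix.smul_apply,
    Matrix.diagonal_mul, Matrix.of_apply, smul_eq_mul]
  split_ifs with hij
  · rw [hij, ← pow_eq_pow_mod _ (isPrimitiveRoot_rootA hn).pow_eq_one, pow_succ']
    ring
  · simp

theorem isWeylPair_clock_shift {n : ℕ} (hn : 2 ≤ n) :
    IsWeylPair n (rootA n) (clock n) (shift n) where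
  isPrimitiveRoot := isPrimitiveRoot_rootA (by omega)
  left_pow_eq_one := clock_pow_self (by omega)
  right_pow_eq_one := shift_pow_self hn
  semiconjBy := semiconjBy_shift_clock (by omega)

theorem relationNumber_le_card {n : ℕ} {S : Finset FreeLie} (hS : IsDefining n (S : Set FreeLie)) :
    relationNumber n ≤ S.card := by
  obtain ⟨T, hTS, hT, lieSpan_eq⟩ := exists_irredundant_subset_lieSpan_eq (R := ℂ) (L := FreeLie) S
  calc relationNumber n ≤ (T : Set FreeLie).encard :=
        sInf_le ⟨T, ⟨hS.1, lieSpan_eq.trans hS.2⟩, hT, rfl⟩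
    _ ≤ (S : Set FreeLie).encard := Set.encard_le_encard (Finset.coe_subset.2 hTS)
    _ = S.card := Set.encard_coe_eq_coe_finsetCard S

theorem lieSpan_genD_genS :
    LieSubalgebra.lieSpan ℂ FreeLie {FreeLieAlgebra.of ℂ Gen.D, FreeLieAlgebra.of ℂ Gen.S} = ⊤ := by
  have range_of : Set.range (FreeLieAlgebra.of ℂ) =
      {FreeLieAlgebra.of ℂ Gen.D, FreeLieAlgebra.of ℂ Gen.S} := by
    ext z
    constructor
    · rintro ⟨_ | _, rfl⟩ <;> simp
    · rintro (rfl | rfl) <;> exact ⟨_, rfl⟩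
  exact range_of ▸ lieSpan_range_of ℂ Gen

theorem exists_isDefining_card_le {n : ℕ} (hn : 2 ≤ n) :
    ∃ S : Finset FreeLie, IsDefining n (S : Set FreeLie) ∧ S.card ≤ max 2 (n ^ 2 - 3) := by
  have : NeZero n := ⟨by omega⟩
  have weylPair : IsWeylPair n (rootA n) (evalHom n (FreeLieAlgebra.of ℂ Gen.D))
      (evalHom n (FreeLieAlgebra.of ℂ Gen.S)) := by
    simpa only [evalHom, FreeLieAlgebra.lift_of_apply, genMatrix] using isWeylPair_clock_shift hn
  have range_eq : (evalHom n).range = LieAlgebra.SpecialLinear.sl (Fin n) ℂ :=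
    LieSubalgebra.toSubmodule_injective <|
      (weylPair.range_eq_weylSpan (evalHom n) hn lieSpan_genD_genS).trans <|
        weylPair.weylSpan_eq_sl (Fintype.card_fin n).symm
  obtain ⟨S, hcard, hS⟩ := weylPair.exists_finset_lieSpan_eq_ker (evalHom n) hn lieSpan_genD_genS
  exact ⟨S, ⟨range_eq, hS⟩, hcard⟩

theorem relationNumber_le_max {n : ℕ} (hn : 2 ≤ n) :
    relationNumber n ≤ (max 2 (n ^ 2 - 3) : ℕ) := by
  obtain ⟨S, hS, hcard⟩ := exists_isDefining_card_le hn
  exact (relationNumber_le_card hS).trans (Nat.cast_le.2 hcard)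

end Sylvester

theorem mainTheorem3 :
    Sylvester.relationNumber 2 ≤ 2 ∧
      ∀ n : ℕ, 3 ≤ n → Sylvester.relationNumber n ≤ ((n ^ 2 - 3 : ℕ) : ℕ∞) := by
  refine ⟨Sylvester.relationNumber_le_max le_rfl, fun n hn ↦ ?_⟩
  have two_le : 2 ≤ n ^ 2 - 3 := Nat.le_sub_of_add_le (by nlinarith)
  exact max_eq_right two_le ▸ Sylvester.relationNumber_le_max (by omega)
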